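/- **Conventions.** A \emph{semi-uniform space} $(X,\mathcal F)$ is a set $X$ with a filter $\mathcal F$ on $X\times X$ such that every $U\in\mathcal F$ contains the diagonal and $U^{-1}\in\mathcal F$ for all $U\in\mathcal F$. A map $f:(X,\mathcal F_X)\to(Y,\mathcal F_Y)$ is \emph{uniformly continuous} if for every $V\in\mathcal F_Y$ there is $U\in\mathcal F_X$ with $(f\times f)(U)\subseteq V$. The product semi-uniform structure on $X\times Y$ is generated by the sets $\{((x,y),(x',y')) : (x,x')\in U,\ (y,y')\in V\}$ with $U\in\mathcal F_X$, $V\in\mathcal F_Y$. The \emph{topological semi-uniform structure} of a topological space $Z$ is the filter generated by the sets $\{(x,y) : \exists W\in\mathcal W,\ x,y\in W\}$, where $\mathcal W$ ranges over the families of subsets of $Z$ whose interiors cover $Z$. For $U\in\mathcal F$ the \emph{Vietoris–Rips complex} $\Sigma^X_U$ is the simplicial complex on the vertex set $X$ in which a non-empty finite set is a simplex iff its elements can be listed without repetition as $x_0,\dots,x_q$ with $(x_i,x_j)\in U$ for all $i<j$ (for symmetric $U$ this is the clique complex of the graph $(X,U)$). For $A\subseteq X$ put $U_A=U\cap(A\times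 A)$; then $\Sigma^A_{U_A}$, defined in the same way on the vertex set $A$, is a subcomplex of $\Sigma^X_U$. For an abelian group $G$ and $n\ge 0$, the \emph{Vietoris–Rips homology and cohomology} of the pair are $$H_n^{VR}(X,A,\mathcal F;G)=\varprojlim_{U\in\mathcal F}H_n(\Sigma^X_U,\Sigma^A_{U_A};G),\qquad H^n_{VR}(X,A,\mathcal F;G)=\varinjlim_{U\in\mathcal F}H^n(\Sigma^X_U,\Sigma^A_{U_A};G),$$ formed from relative simplicial (co)homology (computed from ordered simplicial chains), with $\mathcal F$ directed by inclusion and the maps induced by $\Sigma^X_U\subseteq\Sigma^X_{U'}$ for $U\subseteq U'$. The absolute groups are those with $A=\emptyset$. A uniformly continuous map $f:X\to Y$ with $f(A)\subseteq B$ induces $f_*$ and $f^*$ in the limit, through the simplicial maps $(\Sigma^X_U,\Sigma^A_{U_A})\to(\Sigma^Y_V,\Sigma^B_{V_B})$ for $U\in\mathcal F_X$, $V\in\mathcal F_Y$ with $(f\times f)(U)\subseteq V$. **Theorem (homotopy axiom).** Let $(X,\mathcal F_X)$, $(Y,\mathcal F_Y)$ be semi-uniform spaces, $A\subseteq X$,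 $B\subseteq Y$, and let $f_0,f_1:X\to Y$ be uniformly continuous maps with $f_0(A)\subseteq B$ and $f_1(A)\subseteq B$. Suppose that $f_0$ and $f_1$ are homotopic as maps of pairs: there is a uniformly continuous map $H:X\times[0,1]\to Y$, where $[0,1]$ carries the topological semi-uniform structure of its standard topology and $X\times[0,1]$ the product structure, such that $H(x,0)=f_0(x)$ and $H(x,1)=f_1(x)$ for all $x\in X$, and $H(A\times[0,1])\subseteq B$. Then, for every abelian group $G$ and every $n\ge 0$, $$f_{0*}=f_{1*}:H_n^{VR}(X,A,\mathcal F_X;G)\to H_n^{VR}(Y,B,\mathcal F_Y;G)$$ and $$f_0^*=f_1^*:H^n_{VR}(Y,B,\mathcal F_Y;G)\to H^n_{VR}(X,A,\mathcal F_X;G).$$ In particular (with $A=B=\emptyset$), homotopic uniformly continuous maps induce the same maps on absolute Vietoris–Rips homology and cohomology. -/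

import Mathlib

universe u v w

/-! ## Semi-uniform spaces -/

/-- A semi-uniform structure on `X`: a filter on `X × X` all of whose members contain the diagonal
and which is closed under `U ↦ U⁻¹`. If `X` is non-empty the filter is automatically proper,
because its members contain the diagonal. -/
structure SemiUniformity (X : Type u) where
  entourages : Filter (X × X)
  diag_mem : ∀ U ∈ entourages, ∀ x : X, (x, x) ∈ U
  inv_mem : ∀ U ∈ entourages, {p : X × X | (p.2, p.1) ∈ U} ∈ entourages

namespace SemiUniformity

/-- Uniform continuity of a map of semi-uniform spaces. -/
def UniformlyContinuous {X : Type u} {Y : Type v} (FX : SemiUniformity X) (FY : SemiUniformity Y)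
    (f : X → Y) : Prop :=
  ∀ V ∈ FY.entourages, ∃ U ∈ FX.entourages, ∀ x y : X, (x, y) ∈ U → (f x, f y) ∈ V

/-- The product semi-uniform structure on `X × Y`, generated by the sets
`{((x, y), (x', y')) | (x, x') ∈ U, (y, y') ∈ V}` for `U` in the first and `V` in the second
structure. -/
def prod {X : Type u} {Y : Type v} (FX : SemiUniformity X) (FY : SemiUniformity Y) :
    SemiUniformity (X × Y) where
  entourages := Filter.comap (fun p => (p.1.1, p.2.1)) FX.entourages ⊓
    Filter.comap (fun p => (p.1.2, p.2.2)) FY.entourages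
  diag_mem := by
    intro W hW z
    obtain ⟨W₁, ⟨U, hU, hUW⟩, W₂, ⟨V, hV, hVW⟩, rfl⟩ := hW
    exact ⟨hUW (FX.diag_mem U hU z.1), hVW (FY.diag_mem V hV z.2)⟩
  inv_mem := by
    intro W hW
    obtain ⟨W₁, ⟨U, hU, hUW⟩, W₂, ⟨V, hV, hVW⟩, rfl⟩ := hW
    refine Filter.mem_inf_of_inter (Filter.preimage_mem_comap (FX.inv_mem U hU))
      (Filter.preimage_mem_comap (FY.inv_mem V hV)) ?_
    rintro p ⟨h₁, h₂⟩
    exact ⟨hUW h₁, hVW h₂⟩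

/-- A family of subsets of a topological space is an interior cover if the interiors of its
members cover the space. -/
def IsInteriorCover {Z : Type u} [TopologicalSpace Z] (𝒰 : Set (Set Z)) : Prop :=
  ∀ z : Z, ∃ U ∈ 𝒰, z ∈ interior U

/-- The Vietoris relation of a family of subsets: two points are related if they lie in a common
member. -/
def vietorisRel {Z : Type u} (𝒰 : Set (Set Z)) : Set (Z × Z) :=
  {p | ∃ U ∈ 𝒰, p.1 ∈ U ∧ p.2 ∈ U}

/-- The topological semi-uniform structure of a topological space: the filter generated by the
Vietoris relations of the interior covers. -/
def topological (Z : Type u) [TopologicalSpace Z] : SemiUniformity Z where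
  entourages := Filter.generate {V | ∃ 𝒰 : Set (Set Z), IsInteriorCover 𝒰 ∧ V = vietorisRel 𝒰}
  diag_mem := by
    intro W hW z
    induction hW with
    | basic h =>
      obtain ⟨𝒰, h𝒰, rfl⟩ := h
      obtain ⟨U, hU, hz⟩ := h𝒰 z
      exact ⟨U, hU, interior_subset hz, interior_subset hz⟩
    | univ => trivial
    | superset _ hst ih => exact hst ih
    | inter _ _ ih₁ ih₂ => exact ⟨ih₁, ih₂⟩
  inv_mem := by
    intro W hW
    induction hW with
    | basic h =>
      obtain ⟨𝒰, h𝒰, rfl⟩ := h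
      refine Filter.mem_of_superset (Filter.mem_generate_of_mem ⟨𝒰, h𝒰, rfl⟩) ?_
      rintro p ⟨U, hU, h₁, h₂⟩
      exact ⟨U, hU, h₂, h₁⟩
    | univ => exact Filter.univ_mem
    | superset _ hst ih => exact Filter.mem_of_superset ih fun p hp => hst hp
    | inter _ _ ih₁ ih₂ => exact Filter.inter_mem ih₁ ih₂

/-- A map of semi-uniform pairs `(X, A) → (Y, B)`: a uniformly continuous map `X → Y` that sends
`A` into `B`. -/
structure PairMap {X : Type u} {Y : Type v} (FX : SemiUniformity X) (A : Set X)
    (FY : SemiUniformity Y) (B : Set Y) where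
  toFun : X → Y
  uniformlyContinuous : UniformlyContinuous FX FY toFun
  mapsTo : ∀ a ∈ A, toFun a ∈ B

/-- Two maps of semi-uniform pairs `(X, A) → (Y, B)` are homotopic if there is a uniformly
continuous `H : X × [0, 1] → Y`, where `[0, 1]` carries its topological semi-uniform structure,
with `H(·, 0) = f₀`, `H(·, 1) = f₁` and `H(A × [0, 1]) ⊆ B`. For `A = B = ∅` the last condition is
void and this is homotopy of uniformly continuous maps `X → Y`. -/
def Homotopic {X : Type u} {Y : Type v} {FX : SemiUniformity X} {A : Set X}
    {FY : SemiUniformity Y} {B : Set Y} (f₀ f₁ : PairMap FX A FY B) : Prop :=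
  ∃ H : X × unitInterval → Y, UniformlyContinuous (FX.prod (topological unitInterval)) FY H ∧
    (∀ x, H (x, 0) = f₀.toFun x) ∧ (∀ x, H (x, 1) = f₁.toFun x) ∧
    ∀ a ∈ A, ∀ t : unitInterval, H (a, t) ∈ B

end SemiUniformity

/-! ## Homology and cohomology of pairs of simplicial complexes -/

/-- A pair consisting of a simplicial complex with vertices in `X` and a subcomplex. -/
structure SimplicialPair (X : Type u) where
  total : PreAbstractSimplicialComplex X
  sub : PreAbstractSimplicialComplex X
  sub_le : sub ≤ total

/-- The ordered `n`-simplices of a simplicial complex `K`: tuples `(x₀, …, xₙ)`, possibly with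
repetitions, of vertices of a common simplex of `K`. -/
def OrdSimplex {X : Type u} (K : PreAbstractSimplicialComplex X) (n : ℕ) : Type u :=
  {s : Fin (n + 1) → X // ∃ σ ∈ K, ∀ i, s i ∈ σ}

/-- The `i`-th face of an ordered simplex: the `i`-th vertex is left out. -/
def OrdSimplex.face {X : Type u} {K : PreAbstractSimplicialComplex X} {n : ℕ}
    (s : OrdSimplex K (n + 1)) (i : Fin (n + 2)) : OrdSimplex K n :=
  ⟨fun j => s.1 (i.succAbove j), s.2.imp fun _ hσ => ⟨hσ.1, fun j => hσ.2 (i.succAbove j)⟩⟩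

noncomputable section

/-- `C_n(K; G)`, the ordered simplicial `n`-chains of `K` with coefficients in `G`. -/
abbrev SimplicialChain {X : Type u} (K : PreAbstractSimplicialComplex X) (G : Type w)
    [AddCommGroup G] (n : ℕ) : Type (max u w) :=
  OrdSimplex K n →₀ G

/-- The boundary `∂(x₀, …, xₙ₊₁) = ∑ᵢ (-1)ⁱ (x₀, …, x̂ᵢ, …, xₙ₊₁)`. -/
def simplicialBoundary {X : Type u} (K : PreAbstractSimplicialComplex X) (G : Type w)
    [AddCommGroup G] (n : ℕ) : SimplicialChain K G (n + 1) →ₗ[ℤ] SimplicialChain K G n :=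
  Finsupp.lsum ℤ fun s => ∑ i : Fin (n + 2), ((-1 : ℤ) ^ (i : ℕ)) • Finsupp.lsingle (s.face i)

lemma simplicialBoundary_single {X : Type u} (K : PreAbstractSimplicialComplex X) (G : Type w)
    [AddCommGroup G] (n : ℕ) (s : OrdSimplex K (n + 1)) (g : G) :
    simplicialBoundary K G n (Finsupp.single s g) =
      ∑ i : Fin (n + 2), ((-1 : ℤ) ^ (i : ℕ)) • Finsupp.single (s.face i) g := by
  simp only [simplicialBoundary, Finsupp.lsum_single, LinearMap.sum_apply, LinearMap.smul_apply,
    Finsupp.lsingle_apply]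

namespace SimplicialPair

/-- The subgroup `C_n(L; G)` of `C_n(K; G)`, for a pair `(K, L)`: the chains all of whose simplices
lie in `L`. -/
def subChains {X : Type u} (P : SimplicialPair X) (G : Type w) [AddCommGroup G] (n : ℕ) :
    Submodule ℤ (SimplicialChain P.total G n) :=
  Finsupp.supported G ℤ {s | ∃ σ ∈ P.sub, ∀ i, s.1 i ∈ σ}

lemma subChains_le_iff {X : Type u} (P : SimplicialPair X) (G : Type w) [AddCommGroup G] (n : ℕ)
    (S : Submodule ℤ (SimplicialChain P.total G n)) :
    P.subChains G n ≤ S ↔ ∀ s : OrdSimplex P.total n, (∃ σ ∈ P.sub, ∀ i, s.1 i ∈ σ) →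
      ∀ g : G, Finsupp.single s g ∈ S := by
  constructor
  · intro h s hs g
    exact h (Finsupp.single_mem_supported ℤ g hs)
  · intro h c hc
    rw [← Finsupp.sum_single c]
    exact Submodule.sum_mem _ fun s hs => h s (hc hs) _

lemma subChains_le_boundary {X : Type u} (P : SimplicialPair X) (G : Type w) [AddCommGroup G]
    (n : ℕ) :
    P.subChains G (n + 1) ≤ (P.subChains G n).comap (simplicialBoundary P.total G n) := by
  rw [subChains_le_iff]
  rintro s ⟨σ, hσ, hs⟩ g
  rw [Submodule.mem_comap, simplicialBoundary_single]
  exact Submodule.sum_mem _ fun i _ => Submodule.smul_mem _ _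
    (Finsupp.single_mem_supported ℤ g ⟨σ, hσ, fun j => hs (i.succAbove j)⟩)

/-- The relative chain group `C_n(K, L; G) = C_n(K; G) / C_n(L; G)`. -/
abbrev RelChain {X : Type u} (P : SimplicialPair X) (G : Type w) [AddCommGroup G] (n : ℕ) :
    Type (max u w) :=
  SimplicialChain P.total G n ⧸ P.subChains G n

/-- The boundary map of the relative chain complex. -/
def relBoundary {X : Type u} (P : SimplicialPair X) (G : Type w) [AddCommGroup G] (n : ℕ) :
    P.RelChain G (n + 1) →ₗ[ℤ] P.RelChain G n :=
  Submodule.mapQ _ _ (simplicialBoundary P.total G n) (P.subChains_le_boundary G n)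

/-- The relative cycles; in degree `0` every chain is a cycle. -/
def cycles {X : Type u} (P : SimplicialPair X) (G : Type w) [AddCommGroup G] :
    (n : ℕ) → Submodule ℤ (P.RelChain G n)
  | 0 => ⊤
  | n + 1 => LinearMap.ker (P.relBoundary G n)

/-- The relative boundaries. -/
def boundaries {X : Type u} (P : SimplicialPair X) (G : Type w) [AddCommGroup G] (n : ℕ) :
    Submodule ℤ (P.RelChain G n) :=
  LinearMap.range (P.relBoundary G n)

/-- The relative simplicial homology `H_n(K, L; G)`. -/
def Homology {X : Type u} (P : SimplicialPair X) (G : Type w) [AddCommGroup G] (n : ℕ) :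
    Type (max u w) :=
  P.cycles G n ⧸ (P.boundaries G n).submoduleOf (P.cycles G n)

instance {X : Type u} (P : SimplicialPair X) (G : Type w) [AddCommGroup G] (n : ℕ) :
    AddCommGroup (P.Homology G n) :=
  inferInstanceAs (AddCommGroup (P.cycles G n ⧸ (P.boundaries G n).submoduleOf (P.cycles G n)))

instance {X : Type u} (P : SimplicialPair X) (G : Type w) [AddCommGroup G] (n : ℕ) :
    Module ℤ (P.Homology G n) :=
  inferInstanceAs (Module ℤ (P.cycles G n ⧸ (P.boundaries G n).submoduleOf (P.cycles G n)))

/-- The relative cochain group `Hom(C_n(K, L; ℤ), G)`. -/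
abbrev RelCochain {X : Type u} (P : SimplicialPair X) (G : Type w) [AddCommGroup G] (n : ℕ) :
    Type (max u w) :=
  P.RelChain ℤ n →ₗ[ℤ] G

/-- The coboundary `φ ↦ φ ∘ ∂`. -/
def coboundary {X : Type u} (P : SimplicialPair X) (G : Type w) [AddCommGroup G] (n : ℕ) :
    P.RelCochain G n →ₗ[ℤ] P.RelCochain G (n + 1) :=
  LinearMap.lcomp ℤ G (P.relBoundary ℤ n)

/-- The relative cocycles. -/
def cocycles {X : Type u} (P : SimplicialPair X) (G : Type w) [AddCommGroup G] (n : ℕ) :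
    Submodule ℤ (P.RelCochain G n) :=
  LinearMap.ker (P.coboundary G n)

/-- The relative coboundaries; in degree `0` only `0` is a coboundary. -/
def coboundaries {X : Type u} (P : SimplicialPair X) (G : Type w) [AddCommGroup G] :
    (n : ℕ) → Submodule ℤ (P.RelCochain G n)
  | 0 => ⊥
  | n + 1 => LinearMap.range (P.coboundary G n)

/-- The relative simplicial cohomology `H^n(K, L; G)`. -/
def Cohomology {X : Type u} (P : SimplicialPair X) (G : Type w) [AddCommGroup G] (n : ℕ) :
    Type (max u w) :=
  P.cocycles G n ⧸ (P.coboundaries G n).submoduleOf (P.cocycles G n)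

instance {X : Type u} (P : SimplicialPair X) (G : Type w) [AddCommGroup G] (n : ℕ) :
    AddCommGroup (P.Cohomology G n) :=
  inferInstanceAs (AddCommGroup (P.cocycles G n ⧸ (P.coboundaries G n).submoduleOf (P.cocycles G n)))

instance {X : Type u} (P : SimplicialPair X) (G : Type w) [AddCommGroup G] (n : ℕ) :
    Module ℤ (P.Cohomology G n) :=
  inferInstanceAs (Module ℤ (P.cocycles G n ⧸ (P.coboundaries G n).submoduleOf (P.cocycles G n)))

/-- A simplicial map of pairs: a map of vertices sending simplices to simplices in both
complexes. -/
structure Hom {X : Type u} {Y : Type v} (P : SimplicialPair X) (Q : SimplicialPair Y) where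
  toFun : X → Y
  map_total : ∀ σ ∈ P.total, ∃ τ ∈ Q.total, (τ : Set Y) = toFun '' (σ : Set X)
  map_sub : ∀ σ ∈ P.sub, ∃ τ ∈ Q.sub, (τ : Set Y) = toFun '' (σ : Set X)

namespace Hom

variable {X : Type u} {Y : Type v} {P : SimplicialPair X} {Q : SimplicialPair Y}

/-- The image `(f(x₀), …, f(xₙ))` of an ordered simplex. -/
def ordSimplexMap (f : Hom P Q) (n : ℕ) (s : OrdSimplex P.total n) : OrdSimplex Q.total n :=
  ⟨fun i => f.toFun (s.1 i), by
    obtain ⟨σ, hσ, hs⟩ := s.2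
    obtain ⟨τ, hτ, h⟩ := f.map_total σ hσ
    refine ⟨τ, hτ, fun i => ?_⟩
    rw [← Finset.mem_coe, h]
    exact Set.mem_image_of_mem _ (hs i)⟩

/-- The map induced on chains. -/
def chainMap (f : Hom P Q) (G : Type w) [AddCommGroup G] (n : ℕ) :
    SimplicialChain P.total G n →ₗ[ℤ] SimplicialChain Q.total G n :=
  Finsupp.lmapDomain G ℤ (f.ordSimplexMap n)

lemma subChains_le_chainMap (f : Hom P Q) (G : Type w) [AddCommGroup G] (n : ℕ) :
    P.subChains G n ≤ (Q.subChains G n).comap (f.chainMap G n) := by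
  rw [subChains_le_iff]
  rintro s ⟨σ, hσ, hs⟩ g
  obtain ⟨τ, hτ, h⟩ := f.map_sub σ hσ
  rw [Submodule.mem_comap, chainMap, Finsupp.lmapDomain_apply, Finsupp.mapDomain_single]
  refine Finsupp.single_mem_supported ℤ g ⟨τ, hτ, fun i => ?_⟩
  rw [← Finset.mem_coe, h]
  exact Set.mem_image_of_mem _ (hs i)

/-- The map induced on relative chains. -/
def relChainMap (f : Hom P Q) (G : Type w) [AddCommGroup G] (n : ℕ) :
    P.RelChain G n →ₗ[ℤ] Q.RelChain G n :=
  Submodule.mapQ _ _ (f.chainMap G n) (f.subChains_le_chainMap G n)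

lemma relChainMap_relBoundary (f : Hom P Q) (G : Type w) [AddCommGroup G] (n : ℕ) :
    f.relChainMap G n ∘ₗ P.relBoundary G n = Q.relBoundary G n ∘ₗ f.relChainMap G (n + 1) := by
  apply Submodule.linearMap_qext
  apply Finsupp.lhom_ext
  intro s g
  simp only [relChainMap, relBoundary, LinearMap.comp_apply, Submodule.mkQ_apply,
    Submodule.mapQ_apply, chainMap, simplicialBoundary_single, Finsupp.lmapDomain_apply,
    Finsupp.mapDomain_single, map_sum, map_smul]
  rfl

lemma relChainMap_mem_cycles (f : Hom P Q) (G : Type w) [AddCommGroup G] (n : ℕ) :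
    ∀ c ∈ P.cycles G n, f.relChainMap G n c ∈ Q.cycles G n := by
  cases n with
  | zero => exact fun _ _ => Submodule.mem_top
  | succ n =>
    intro c hc
    have hc' : P.relBoundary G n c = 0 := hc
    have h := LinearMap.congr_fun (f.relChainMap_relBoundary G n) c
    simp only [LinearMap.comp_apply, hc', map_zero] at h
    exact h.symm

/-- The map induced on relative homology. -/
def homologyMap (f : Hom P Q) (G : Type w) [AddCommGroup G] (n : ℕ) :
    P.Homology G n →ₗ[ℤ] Q.Homology G n :=
  Submodule.mapQ _ _ ((f.relChainMap G n).restrict (f.relChainMap_mem_cycles G n)) (by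
    rintro ⟨c, hc⟩ ⟨b, hb⟩
    refine ⟨f.relChainMap G (n + 1) b, ?_⟩
    have h := LinearMap.congr_fun (f.relChainMap_relBoundary G n) b
    simp only [LinearMap.comp_apply, hb] at h
    exact h.symm)

/-- The map induced on relative cochains, `φ ↦ φ ∘ f`. -/
def relCochainMap (f : Hom P Q) (G : Type w) [AddCommGroup G] (n : ℕ) :
    Q.RelCochain G n →ₗ[ℤ] P.RelCochain G n :=
  LinearMap.lcomp ℤ G (f.relChainMap ℤ n)

lemma relCochainMap_coboundary (f : Hom P Q) (G : Type w) [AddCommGroup G] (n : ℕ)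
    (φ : Q.RelCochain G n) :
    f.relCochainMap G (n + 1) (Q.coboundary G n φ) =
      P.coboundary G n (f.relCochainMap G n φ) := by
  refine LinearMap.ext fun c => ?_
  exact congrArg φ (LinearMap.congr_fun (f.relChainMap_relBoundary ℤ n) c).symm

lemma relCochainMap_mem_cocycles (f : Hom P Q) (G : Type w) [AddCommGroup G] (n : ℕ) :
    ∀ φ ∈ Q.cocycles G n, f.relCochainMap G n φ ∈ P.cocycles G n := by
  intro φ hφ
  have hφ' : Q.coboundary G n φ = 0 := hφ
  change P.coboundary G n (f.relCochainMap G n φ) = 0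
  rw [← relCochainMap_coboundary, hφ', map_zero]

lemma relCochainMap_mem_coboundaries (f : Hom P Q) (G : Type w) [AddCommGroup G] (n : ℕ) :
    ∀ φ ∈ Q.coboundaries G n, f.relCochainMap G n φ ∈ P.coboundaries G n := by
  cases n with
  | zero =>
    intro φ hφ
    have hφ' : φ = 0 := hφ
    rw [hφ', map_zero]
    exact Submodule.zero_mem _
  | succ n =>
    rintro φ ⟨ψ, rfl⟩
    exact ⟨f.relCochainMap G n ψ, (f.relCochainMap_coboundary G n ψ).symm⟩

/-- The map induced on relative cohomology. -/
def cohomologyMap (f : Hom P Q) (G : Type w) [AddCommGroup G] (n : ℕ) :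
    Q.Cohomology G n →ₗ[ℤ] P.Cohomology G n :=
  Submodule.mapQ _ _ ((f.relCochainMap G n).restrict (f.relCochainMap_mem_cocycles G n))
    fun φ hφ => f.relCochainMap_mem_coboundaries G n φ.1 hφ

end Hom

/-- If two composites of simplicial maps of pairs agree on vertices, they induce the same map on
homology. -/
lemma homologyMap_comm {X : Type*} {Y : Type*} {Y' : Type*} {Z : Type*} {P : SimplicialPair X}
    {Q : SimplicialPair Y} {Q' : SimplicialPair Y'} {R : SimplicialPair Z} (f : Hom P Q)
    (g : Hom Q R) (f' : Hom P Q') (g' : Hom Q' R)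
    (h : ∀ x, g.toFun (f.toFun x) = g'.toFun (f'.toFun x)) (G : Type w) [AddCommGroup G] (n : ℕ)
    (a : P.Homology G n) :
    g.homologyMap G n (f.homologyMap G n a) = g'.homologyMap G n (f'.homologyMap G n a) := by
  obtain ⟨⟨c, hc⟩, rfl⟩ := Submodule.Quotient.mk_surjective _ a
  obtain ⟨c, rfl⟩ := Submodule.Quotient.mk_surjective _ c
  refine congrArg (Submodule.Quotient.mk) (Subtype.ext (congrArg Submodule.Quotient.mk ?_))
  change Finsupp.mapDomain _ (Finsupp.mapDomain _ c) = Finsupp.mapDomain _ (Finsupp.mapDomain _ c)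
  rw [← Finsupp.mapDomain_comp, ← Finsupp.mapDomain_comp]
  congr 1
  funext s
  exact Subtype.ext (funext fun i => h (s.1 i))

/-- If two composites of simplicial maps of pairs agree on vertices, they induce the same map on
cohomology. -/
lemma cohomologyMap_comm {X : Type*} {Y : Type*} {Y' : Type*} {Z : Type*} {P : SimplicialPair X}
    {Q : SimplicialPair Y} {Q' : SimplicialPair Y'} {R : SimplicialPair Z} (f : Hom P Q)
    (g : Hom Q R) (f' : Hom P Q') (g' : Hom Q' R)
    (h : ∀ x, g.toFun (f.toFun x) = g'.toFun (f'.toFun x)) (G : Type w) [AddCommGroup G] (n : ℕ)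
    (a : R.Cohomology G n) :
    f.cohomologyMap G n (g.cohomologyMap G n a) =
      f'.cohomologyMap G n (g'.cohomologyMap G n a) := by
  obtain ⟨⟨φ, hφ⟩, rfl⟩ := Submodule.Quotient.mk_surjective _ a
  refine congrArg (Submodule.Quotient.mk) (Subtype.ext (LinearMap.ext fun c => ?_))
  obtain ⟨c, rfl⟩ := Submodule.Quotient.mk_surjective _ c
  refine congrArg φ (congrArg Submodule.Quotient.mk ?_)
  change Finsupp.mapDomain _ (Finsupp.mapDomain _ c) = Finsupp.mapDomain _ (Finsupp.mapDomain _ c)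
  rw [← Finsupp.mapDomain_comp, ← Finsupp.mapDomain_comp]
  congr 1
  funext s
  exact Subtype.ext (funext fun i => h (s.1 i))

end SimplicialPair

/-! ## Vietoris-Rips homology and cohomology -/

/-- The Vietoris-Rips complex of a relation `U` on a subset `A` of `X`: the directed clique complex
of the graph with vertex set `A` and edge set `U`. A non-empty finite subset of `A` is a simplex iff
its elements can be listed (without repetition) as `x₀, …, x_q` with `(x_i, x_j) ∈ U` for all
`i < j`. If `U` is symmetric, this is the clique complex. -/
def vietorisRips {X : Type u} (A : Set X) (U : Set (X × X)) : PreAbstractSimplicialComplex X where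
  faces := {σ | σ.Nonempty ∧ (σ : Set X) ⊆ A ∧
    ∃ l : List X, l.Nodup ∧ (∀ x, x ∈ l ↔ x ∈ σ) ∧ l.Pairwise fun x y => (x, y) ∈ U}
  isRelLowerSet_faces := by
    rintro σ ⟨hne, hA, l, hl, hmem, hU⟩
    refine ⟨hne, fun τ hτσ hτ => ⟨hτ, (Finset.coe_subset.2 hτσ).trans hA, ?_⟩⟩
    classical
    refine ⟨l.filter (· ∈ τ), hl.filter _, fun x => ?_, hU.filter _⟩
    simp only [List.mem_filter, decide_eq_true_eq, hmem]
    exact ⟨fun h => h.2, fun h => ⟨hτσ h, h⟩⟩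

lemma mem_vietorisRips_map {X : Type u} {Y : Type v} {A : Set X} {U : Set (X × X)} {B : Set Y}
    {V : Set (Y × Y)} (f : X → Y) (hAB : ∀ a ∈ A, f a ∈ B)
    (hUV : ∀ x y, (x, y) ∈ U → (f x, f y) ∈ V) (σ : Finset X) (hσ : σ ∈ vietorisRips A U) :
    ∃ τ ∈ vietorisRips B V, (τ : Set Y) = f '' (σ : Set X) := by
  classical
  obtain ⟨hne, hA, l, hl, hmem, hU⟩ := hσ
  refine ⟨σ.image f, ⟨hne.image f, ?_, (l.map f).dedup, List.nodup_dedup _, fun y => ?_, ?_⟩,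
    Finset.coe_image⟩
  · rw [Finset.coe_image]
    rintro _ ⟨x, hx, rfl⟩
    exact hAB x (hA hx)
  · simp [hmem]
  · exact List.Pairwise.sublist (List.dedup_sublist _)
      (List.pairwise_map.2 (hU.imp fun h => hUV _ _ h))

/-- The pair of simplicial complexes `(Σ^X_U, Σ^A_{U_A})`, where `U_A = U ∩ (A × A)`. -/
def vietorisRipsPair {X : Type u} (A : Set X) (U : Set (X × X)) : SimplicialPair X where
  total := vietorisRips Set.univ U
  sub := vietorisRips A (U ∩ A ×ˢ A)
  sub_le := by
    rintro σ ⟨hne, -, l, hl, hmem, hU⟩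
    exact ⟨hne, Set.subset_univ _, l, hl, hmem, hU.imp fun h => h.1⟩

/-- The simplicial map of pairs `(Σ^X_U, Σ^A_{U_A}) → (Σ^Y_V, Σ^B_{V_B})` induced by a map
`f : X → Y` with `f(A) ⊆ B` and `f(U) ⊆ V`. -/
def vietorisRipsMap {X : Type u} {Y : Type v} {A : Set X} {U : Set (X × X)} {B : Set Y}
    {V : Set (Y × Y)} (f : X → Y) (hAB : ∀ a ∈ A, f a ∈ B)
    (hUV : ∀ x y, (x, y) ∈ U → (f x, f y) ∈ V) :
    (vietorisRipsPair A U).Hom (vietorisRipsPair B V) where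
  toFun := f
  map_total := mem_vietorisRips_map f (fun _ _ => Set.mem_univ _) hUV
  map_sub := mem_vietorisRips_map f hAB fun x y h =>
    ⟨hUV x y h.1, hAB x h.2.1, hAB y h.2.2⟩

namespace SemiUniformity

/-- The members of a semi-uniform structure, ordered by inclusion. -/
abbrev Entourage {X : Type u} (FX : SemiUniformity X) : Type u :=
  {U : Set (X × X) // U ∈ FX.entourages}

/-- The inclusion of pairs `(Σ^X_U, Σ^A_{U_A}) → (Σ^X_{U'}, Σ^A_{U'_A})` for `U ⊆ U'`. -/
def inclusion {X : Type u} {FX : SemiUniformity X} (A : Set X) {U U' : FX.Entourage}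
    (h : U ≤ U') : (vietorisRipsPair A U.1).Hom (vietorisRipsPair A U'.1) :=
  vietorisRipsMap id (fun _ ha => ha) fun _ _ hxy => h hxy

/-- The Vietoris-Rips homology `H_n^{VR}(X, A, ℱ; G) = lim H_n(Σ^X_U, Σ^A_{U_A}; G)`, the inverse
limit over `U ∈ ℱ`, realized as the group of compatible families. -/
def vrHomology {X : Type u} (FX : SemiUniformity X) (A : Set X) (G : Type w) [AddCommGroup G]
    (n : ℕ) : Submodule ℤ (∀ U : FX.Entourage, (vietorisRipsPair A U.1).Homology G n) where
  carrier := {a | ∀ (U U' : FX.Entourage) (h : U ≤ U'),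
    (inclusion A h).homologyMap G n (a U) = a U'}
  zero_mem' := fun _ _ _ => map_zero _
  add_mem' := fun ha hb U U' h =>
    (map_add _ _ _).trans (congrArg₂ (· + ·) (ha U U' h) (hb U U' h))
  smul_mem' := fun k _ ha U U' h => (map_smul _ k _).trans (congrArg (k • ·) (ha U U' h))

open scoped Classical in
/-- The Vietoris-Rips cohomology `H^n_{VR}(X, A, ℱ; G) = colim H^n(Σ^X_U, Σ^A_{U_A}; G)`, the direct
limit over `U ∈ ℱ`, ordered by reverse inclusion. -/
abbrev VRCohomology {X : Type u} (FX : SemiUniformity X) (A : Set X) (G : Type w) [AddCommGroup G]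
    (n : ℕ) : Type (max u w) :=
  Module.DirectLimit (R := ℤ) (ι := (FX.Entourage)ᵒᵈ)
    (fun U => (vietorisRipsPair A (OrderDual.ofDual U).1).Cohomology G n)
    fun _ _ h => (inclusion A (OrderDual.ofDual_le_ofDual.2 h)).cohomologyMap G n

open scoped Classical in
/-- The canonical map `H^n(Σ^X_U, Σ^A_{U_A}; G) → H^n_{VR}(X, A, ℱ; G)`. -/
def vrCohomologyOf {X : Type u} (FX : SemiUniformity X) (A : Set X) (G : Type w) [AddCommGroup G]
    (n : ℕ) (U : FX.Entourage) :
    (vietorisRipsPair A U.1).Cohomology G n →ₗ[ℤ] FX.VRCohomology A G n :=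
  Module.DirectLimit.of ℤ (FX.Entourage)ᵒᵈ
    (fun U => (vietorisRipsPair A (OrderDual.ofDual U).1).Cohomology G n)
    (fun _ _ h => (inclusion A (OrderDual.ofDual_le_ofDual.2 h)).cohomologyMap G n)
    (OrderDual.toDual U)

lemma vrCohomologyOf_inclusion {X : Type u} (FX : SemiUniformity X) (A : Set X) (G : Type w)
    [AddCommGroup G] (n : ℕ) {U U' : FX.Entourage} (h : U ≤ U')
    (a : (vietorisRipsPair A U'.1).Cohomology G n) :
    FX.vrCohomologyOf A G n U ((inclusion A h).cohomologyMap G n a) =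
      FX.vrCohomologyOf A G n U' a := by
  classical
  exact Module.DirectLimit.of_f (R := ℤ) (ι := (FX.Entourage)ᵒᵈ)
    (G := fun U => (vietorisRipsPair A (OrderDual.ofDual U).1).Cohomology G n)
    (f := fun _ _ h => (inclusion A (OrderDual.ofDual_le_ofDual.2 h)).cohomologyMap G n)
    (hij := OrderDual.toDual_le_toDual.2 h)

namespace PairMap

variable {X : Type u} {Y : Type v} {FX : SemiUniformity X} {A : Set X} {FY : SemiUniformity Y}
  {B : Set Y}

/-- The largest member `U` of the semi-uniform structure of `X` with `f(U) ⊆ V`. -/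
def pullback (f : PairMap FX A FY B) (V : FY.Entourage) : FX.Entourage :=
  ⟨{p | (f.toFun p.1, f.toFun p.2) ∈ V.1}, by
    obtain ⟨U, hU, h⟩ := f.uniformlyContinuous V.1 V.2
    exact Filter.mem_of_superset hU fun p hp => h p.1 p.2 hp⟩

lemma pullback_mono (f : PairMap FX A FY B) {V V' : FY.Entourage} (h : V ≤ V') :
    f.pullback V ≤ f.pullback V' :=
  fun _ hp => h hp

/-- The simplicial map of pairs `(Σ^X_U, Σ^A_{U_A}) → (Σ^Y_V, Σ^B_{V_B})` induced by `f`, for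
members `U`, `V` of the semi-uniform structures with `f(U) ⊆ V`. -/
def simplicialMap (f : PairMap FX A FY B) {U : FX.Entourage} {V : FY.Entourage}
    (h : U ≤ f.pullback V) : (vietorisRipsPair A U.1).Hom (vietorisRipsPair B V.1) :=
  vietorisRipsMap f.toFun f.mapsTo fun _ _ hxy => h hxy

/-- The map `f_*` induced on Vietoris-Rips homology: the component at `V` of the image of a
compatible family `(a_U)` is the image of `a_U` under `Σ^X_U → Σ^Y_V`, where `f(U) ⊆ V`. By
compatibility this does not depend on the choice of `U`, and the largest one is used. -/
def homologyMap (f : PairMap FX A FY B) (G : Type w) [AddCommGroup G] (n : ℕ) :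
    FX.vrHomology A G n →ₗ[ℤ] FY.vrHomology B G n where
  toFun a := ⟨fun V => (f.simplicialMap (le_refl (f.pullback V))).homologyMap G n
      (a.1 (f.pullback V)), fun V V' h => by
    have h' := f.pullback_mono h
    have ha := a.2 _ _ h'
    exact (SimplicialPair.homologyMap_comm (f.simplicialMap (le_refl (f.pullback V)))
      (inclusion B h) (inclusion A h') (f.simplicialMap (le_refl (f.pullback V')))
      (fun _ => rfl) G n _).trans (congrArg _ ha)⟩
  map_add' _ _ := Subtype.ext (funext fun _ => map_add _ _ _)
  map_smul' k _ := Subtype.ext (funext fun _ => map_smul _ k _)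

lemma homologyMap_apply (f : PairMap FX A FY B) (G : Type w) [AddCommGroup G] (n : ℕ)
    (a : FX.vrHomology A G n) {U : FX.Entourage} {V : FY.Entourage} (h : U ≤ f.pullback V) :
    (f.homologyMap G n a).1 V = (f.simplicialMap h).homologyMap G n (a.1 U) := by
  change (f.simplicialMap (le_refl (f.pullback V))).homologyMap G n (a.1 (f.pullback V)) = _
  have hid : (inclusion A (le_refl U)).homologyMap G n (a.1 U) = a.1 U := a.2 _ _ le_rfl
  rw [← a.2 _ _ h]
  exact (SimplicialPair.homologyMap_comm (inclusion A h)
    (f.simplicialMap (le_refl (f.pullback V))) (inclusion A (le_refl U)) (f.simplicialMap h)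
    (fun _ => rfl) G n _).trans (congrArg _ hid)

/-- The composite `H^n(Σ^Y_V, Σ^B_{V_B}; G) → H^n(Σ^X_U, Σ^A_{U_A}; G) → H^n_{VR}(X, A, ℱ; G)`,
where `U` is the largest member with `f(U) ⊆ V`. -/
def cohomologyMapAt (f : PairMap FX A FY B) (G : Type w) [AddCommGroup G] (n : ℕ)
    (V : FY.Entourage) :
    (vietorisRipsPair B V.1).Cohomology G n →ₗ[ℤ] FX.VRCohomology A G n :=
  FX.vrCohomologyOf A G n (f.pullback V) ∘ₗ
    (f.simplicialMap (le_refl (f.pullback V))).cohomologyMap G n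

lemma cohomologyMapAt_apply (f : PairMap FX A FY B) (G : Type w) [AddCommGroup G] (n : ℕ)
    {U : FX.Entourage} {V : FY.Entourage} (h : U ≤ f.pullback V)
    (b : (vietorisRipsPair B V.1).Cohomology G n) :
    f.cohomologyMapAt G n V b =
      FX.vrCohomologyOf A G n U ((f.simplicialMap h).cohomologyMap G n b) := by
  have e₁ := SimplicialPair.cohomologyMap_comm (inclusion A h)
    (f.simplicialMap (le_refl (f.pullback V))) (inclusion A (le_refl U)) (f.simplicialMap h)
    (fun _ => rfl) G n b
  have e₂ := FX.vrCohomologyOf_inclusion A G n (le_refl U)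
    ((f.simplicialMap h).cohomologyMap G n b)
  rw [← e₂, ← e₁, vrCohomologyOf_inclusion]
  rfl

lemma cohomologyMapAt_inclusion (f : PairMap FX A FY B) (G : Type w) [AddCommGroup G] (n : ℕ)
    {V V' : FY.Entourage} (h : V ≤ V') (b : (vietorisRipsPair B V'.1).Cohomology G n) :
    f.cohomologyMapAt G n V ((inclusion B h).cohomologyMap G n b) =
      f.cohomologyMapAt G n V' b := by
  have h' := f.pullback_mono h
  have e₁ := SimplicialPair.cohomologyMap_comm (f.simplicialMap (le_refl (f.pullback V)))
    (inclusion B h) (inclusion A (le_refl (f.pullback V))) (f.simplicialMap h')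
    (fun _ => rfl) G n b
  rw [cohomologyMapAt_apply f G n h', cohomologyMapAt, LinearMap.comp_apply, e₁,
    vrCohomologyOf_inclusion]

open scoped Classical in
/-- The map `f^*` induced on Vietoris-Rips cohomology: the class of `b ∈ H^n(Σ^Y_V, Σ^B_{V_B}; G)`
goes to the class of its image under `Σ^X_U → Σ^Y_V`, where `f(U) ⊆ V`. This does not depend on the
choice of `U`, and the largest one is used. -/
def cohomologyMap (f : PairMap FX A FY B) (G : Type w) [AddCommGroup G] (n : ℕ) :
    FY.VRCohomology B G n →ₗ[ℤ] FX.VRCohomology A G n :=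
  Module.DirectLimit.lift ℤ (FY.Entourage)ᵒᵈ _ _
    (fun V => f.cohomologyMapAt G n (OrderDual.ofDual V))
    fun _ _ h b => f.cohomologyMapAt_inclusion G n (OrderDual.ofDual_le_ofDual.2 h) b

lemma cohomologyMap_of (f : PairMap FX A FY B) (G : Type w) [AddCommGroup G] (n : ℕ)
    {U : FX.Entourage} {V : FY.Entourage} (h : U ≤ f.pullback V)
    (b : (vietorisRipsPair B V.1).Cohomology G n) :
    f.cohomologyMap G n (FY.vrCohomologyOf B G n V b) =
      FX.vrCohomologyOf A G n U ((f.simplicialMap h).cohomologyMap G n b) := by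
  classical
  rw [← cohomologyMapAt_apply f G n h]
  exact Module.DirectLimit.lift_of (R := ℤ) (ι := (FY.Entourage)ᵒᵈ) _ _ _

end PairMap

end SemiUniformity

end

/-!
The homotopy axiom is reduced to the invariance of simplicial (co)homology under contiguity.

Fix a member `V` of the semi-uniform structure of `Y`. Uniform continuity of `H` gives members `U`
and `W` of the structures of `X` and `[0, 1]` such that `H` sends `U`-related points at `W`-related
times to `V`-related points. Every point of `[0, 1]` has a neighbourhood all of whose pairs lie in
`W`, so by compactness there are times `0 = t₀ ≤ t₁ ≤ … ≤ t_N = 1` such that any two points of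
`[t_k, t_{k+1}]` are `W`-related. Each stage `H(·, t_k)` is then a simplicial map of pairs
`(Σ^X_U, Σ^A_{U_A}) → (Σ^Y_V, Σ^B_{V_B})`, and consecutive stages `p`, `q` are contiguous: if
`x₀, …, xₙ` lists a simplex, then `p x₀, q x₀, p x₁, q x₁, …` (with repetitions dropped) lists a
simplex containing both images (`SimplicialPair.Contiguous.vietorisRips`).

Contiguous maps are chain homotopic through the prism operator
`(x₀, …, xₙ) ↦ ∑ᵢ (-1)ⁱ (p x₀, …, p xᵢ, q xᵢ, …, q xₙ)`. The prism identity is proved in the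
augmented complex of chains on finite lists (`ListChain.boundary_prism`). There both the boundary
and the prism operator are defined by recursion on the list, in terms of the cone operator
`l ↦ x :: l`, and the identity becomes a short induction. It is carried over to ordered simplices
along the injection sending a simplex to its list of vertices.

Hence `f₀` and `f₁` already agree on the (co)homology of the pairs indexed by `U` and `V`
(`SemiUniformity.Homotopic.exists_simplicialMap_eq`), and so in the limit.
-/

noncomputable section

/-! ### Chains on finite lists -/

namespace ListChain

variable {X : Type u} {Y : Type v} (G : Type w) [AddCommGroup G]

/-- The cone operator on chains of lists: the vertex `x` is put in front of every list. -/
def cone (x : X) : (List X →₀ G) →ₗ[ℤ] (List X →₀ G) :=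
  Finsupp.lmapDomain G ℤ (List.cons x)

@[simp]
lemma cone_single (x : X) (l : List X) (a : G) :
    cone G x (Finsupp.single l a) = Finsupp.single (x :: l) a := by
  simp [cone]

/-- The boundary of a list, by recursion: `∂ (x :: l) = l - x * ∂ l`. The empty list plays the role
of the simplex of dimension `-1`. -/
def boundaryList : List X → G →ₗ[ℤ] (List X →₀ G)
  | [] => 0
  | x :: l => Finsupp.lsingle l - cone G x ∘ₗ boundaryList l

/-- The boundary map on chains of lists. -/
def boundary : (List X →₀ G) →ₗ[ℤ] (List X →₀ G) :=
  Finsupp.lsum ℤ (boundaryList G)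

lemma boundary_single (l : List X) (a : G) :
    boundary G (Finsupp.single l a) = boundaryList G l a := by
  simp [boundary]

lemma boundary_cone (x : X) (c : List X →₀ G) :
    boundary G (cone G x c) = c - cone G x (boundary G c) := by
  induction c using Finsupp.induction_linear with
  | zero => simp
  | add c d hc hd => simp only [map_add, hc, hd]; abel
  | single l a => simp [boundary_single, boundaryList]

/-- The prism over a list, by recursion:
`D (x :: l) = (f x :: g x :: g l) - f x * D l`. -/
def prismList (f g : X → Y) : List X → G →ₗ[ℤ] (List Y →₀ G)
  | [] => 0
  | x :: l => Finsupp.lsingle (f x :: g x :: l.map g) - cone G (f x) ∘ₗ prismList f g l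

/-- The prism operator on chains of lists. -/
def prism (f g : X → Y) : (List X →₀ G) →ₗ[ℤ] (List Y →₀ G) :=
  Finsupp.lsum ℤ (prismList G f g)

lemma prism_single (f g : X → Y) (l : List X) (a : G) :
    prism G f g (Finsupp.single l a) = prismList G f g l a := by
  simp [prism]

lemma prism_cone (f g : X → Y) (x : X) (c : List X →₀ G) :
    prism G f g (cone G x c) =
      cone G (f x) (cone G (g x) (Finsupp.lmapDomain G ℤ (List.map g) c)) -
        cone G (f x) (prism G f g c) := by
  induction c using Finsupp.induction_linear with
  | zero => simp
  | add c d hc hd => simp only [map_add, hc, hd]; abel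
  | single l a => simp [prism_single, prismList]

lemma boundary_lmapDomain (g : X → Y) (c : List X →₀ G) :
    boundary G (Finsupp.lmapDomain G ℤ (List.map g) c) =
      Finsupp.lmapDomain G ℤ (List.map g) (boundary G c) := by
  have hcone (x : X) (c : List X →₀ G) : Finsupp.lmapDomain G ℤ (List.map g) (cone G x c) =
      cone G (g x) (Finsupp.lmapDomain G ℤ (List.map g) c) := by
    simp only [cone, Finsupp.lmapDomain_apply, ← Finsupp.mapDomain_comp]
    rfl
  induction c using Finsupp.induction_linear with
  | zero => simp
  | add c d hc hd => simp only [map_add, hc, hd]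
  | single l a =>
    induction l with
    | nil => simp [boundary_single, boundaryList]
    | cons x l ih =>
      rw [← cone_single, hcone, boundary_cone, boundary_cone, ih, map_sub, hcone]

/-- The prism identity `∂ D + D ∂ = g - f`. Because of the augmentation it holds for all lists,
without an exception in the lowest degree. -/
theorem boundary_prism (f g : X → Y) (c : List X →₀ G) :
    boundary G (prism G f g c) + prism G f g (boundary G c) =
      Finsupp.lmapDomain G ℤ (List.map g) c - Finsupp.lmapDomain G ℤ (List.map f) c := by
  induction c using Finsupp.induction_linear with
  | zero => simp
  | add c d hc hd =>
    simp only [map_add]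
    rw [add_add_add_comm, hc, hd]
    abel
  | single l a =>
    induction l with
    | nil => simp [prism_single, prismList, boundary_single, boundaryList]
    | cons x l ih =>
      have hf : Finsupp.lmapDomain G ℤ (List.map f) (Finsupp.single (x :: l) a) =
          cone G (f x) (Finsupp.lmapDomain G ℤ (List.map f) (Finsupp.single l a)) := by simp
      have hg : Finsupp.lmapDomain G ℤ (List.map g) (Finsupp.single (x :: l) a) =
          cone G (g x) (Finsupp.lmapDomain G ℤ (List.map g) (Finsupp.single l a)) := by simp
      rw [hf, hg, ← cone_single, prism_cone, boundary_cone, map_sub, map_sub, boundary_cone,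
        boundary_cone, boundary_cone, prism_cone, boundary_lmapDomain, eq_sub_of_add_eq ih]
      simp only [map_sub]
      abel

end ListChain

/-! ### The prism operator of contiguous maps -/

namespace SimplicialPair

section ToList

variable {X : Type u} {K : PreAbstractSimplicialComplex X} (G : Type w) [AddCommGroup G]

/-- The embedding of ordered chains into chains of lists: an ordered simplex goes to the list of
its vertices. -/
def toListChain (K : PreAbstractSimplicialComplex X) (n : ℕ) :
    SimplicialChain K G n →ₗ[ℤ] (List X →₀ G) :=
  Finsupp.lmapDomain G ℤ fun s => List.ofFn s.1

lemma toListChain_single (n : ℕ) (s : OrdSimplex K n) (a : G) :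
    toListChain G K n (Finsupp.single s a) = Finsupp.single (List.ofFn s.1) a := by
  simp [toListChain]

lemma toListChain_injective (n : ℕ) : Function.Injective (toListChain G K n) :=
  Finsupp.mapDomain_injective fun _ _ h => Subtype.ext (List.ofFn_injective h)

lemma boundaryList_ofFn (n : ℕ) (s : Fin (n + 1) → X) (a : G) :
    ListChain.boundaryList G (List.ofFn s) a =
      ∑ i : Fin (n + 1), ((-1 : ℤ) ^ (i : ℕ)) •
        Finsupp.single (List.ofFn fun j => s (i.succAbove j)) a := by
  induction n with
  | zero => simp [ListChain.boundaryList]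
  | succ n ih =>
    rw [List.ofFn_succ, ListChain.boundaryList, Fin.sum_univ_succ]
    simp only [LinearMap.sub_apply, LinearMap.comp_apply, Finsupp.lsingle_apply, ih, map_sum,
      map_smul, ListChain.cone_single, Fin.val_zero, pow_zero, one_smul, Fin.zero_succAbove,
      Fin.val_succ, pow_succ, mul_neg_one, neg_smul, Finset.sum_neg_distrib]
    rw [sub_eq_add_neg]
    congr 2
    refine Finset.sum_congr rfl fun i _ => ?_
    rw [List.ofFn_succ (f := fun j => s (i.succ.succAbove j))]
    simp only [Fin.succ_succAbove_zero, Fin.succ_succAbove_succ]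

lemma toListChain_boundary (n : ℕ) (c : SimplicialChain K G (n + 1)) :
    toListChain G K n (simplicialBoundary K G n c) =
      ListChain.boundary G (toListChain G K (n + 1) c) := by
  induction c using Finsupp.induction_linear with
  | zero => simp
  | add c d hc hd => simp only [map_add, hc, hd]
  | single s a =>
    rw [simplicialBoundary_single, toListChain_single, ListChain.boundary_single,
      boundaryList_ofFn]
    simp only [map_sum, map_smul, toListChain_single]
    rfl

end ToList

variable {X : Type u} {Y : Type v} {P : SimplicialPair X} {Q : SimplicialPair Y}

lemma toListChain_chainMap (f : Hom P Q) (G : Type w) [AddCommGroup G]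
    (n : ℕ) (c : SimplicialChain P.total G n) :
    toListChain G Q.total n (f.chainMap G n c) =
      Finsupp.lmapDomain G ℤ (List.map f.toFun) (toListChain G P.total n c) := by
  simp only [toListChain, Hom.chainMap, Finsupp.lmapDomain_apply, ← Finsupp.mapDomain_comp]
  congr 1
  funext s
  change List.ofFn (f.toFun ∘ s.1) = (List.ofFn s.1).map f.toFun
  exact List.map_ofFn.symm

/-- Two simplicial maps of pairs are contiguous if, in the total complexes as well as in the
subcomplexes, the two images of any simplex are faces of a common simplex. -/
structure Contiguous (f g : Hom P Q) : Prop where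
  total : ∀ σ ∈ P.total, ∃ τ ∈ Q.total, ∀ x ∈ σ, f.toFun x ∈ τ ∧ g.toFun x ∈ τ
  sub : ∀ σ ∈ P.sub, ∃ τ ∈ Q.sub, ∀ x ∈ σ, f.toFun x ∈ τ ∧ g.toFun x ∈ τ

/-- The tuple `(f s₀, …, f sᵢ, g sᵢ, …, g sₙ)`. -/
def prismTuple (f g : X → Y) {n : ℕ} (s : Fin (n + 1) → X) (i : Fin (n + 1)) : Fin (n + 2) → Y :=
  fun j => if i.castSucc < j then g (s (i.predAbove j)) else f (s (i.predAbove j))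

lemma prismList_ofFn (f g : X → Y) (G : Type w) [AddCommGroup G] (n : ℕ) (s : Fin (n + 1) → X)
    (a : G) :
    ListChain.prismList G f g (List.ofFn s) a =
      ∑ i : Fin (n + 1), ((-1 : ℤ) ^ (i : ℕ)) •
        Finsupp.single (List.ofFn (prismTuple f g s i)) a := by
  have h0 (n : ℕ) (s : Fin (n + 1) → X) : List.ofFn (prismTuple f g s 0) =
      f (s 0) :: g (s 0) :: (List.ofFn fun i : Fin n => s i.succ).map g := by
    rw [List.ofFn_succ, List.ofFn_succ, List.map_ofFn]
    simp [prismTuple, Function.comp_def]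
  induction n with
  | zero =>
    rw [List.ofFn_succ, ListChain.prismList, Fin.sum_univ_succ, h0]
    simp [ListChain.prismList]
  | succ n ih =>
    rw [List.ofFn_succ, ListChain.prismList, Fin.sum_univ_succ, h0]
    simp only [LinearMap.sub_apply, LinearMap.comp_apply, Finsupp.lsingle_apply, ih, map_sum,
      map_smul, ListChain.cone_single, Fin.val_zero, pow_zero, one_smul,
      Fin.val_succ, pow_succ, mul_neg_one, neg_smul, Finset.sum_neg_distrib]
    rw [sub_eq_add_neg]
    congr 2
    refine Finset.sum_congr rfl fun i _ => ?_
    rw [List.ofFn_succ (f := prismTuple f g s i.succ)]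
    have hz : prismTuple f g s i.succ 0 = f (s 0) := by
      simp [prismTuple]
    have hs (j : Fin (n + 2)) : prismTuple f g s i.succ j.succ =
        prismTuple f g (fun k => s k.succ) i j := by
      simp only [prismTuple, Fin.succ_predAbove_succ, ← Fin.succ_castSucc, Fin.succ_lt_succ_iff]
    simp only [hz, hs]

lemma prismTuple_mem {f g : X → Y} {n : ℕ} {σ : Finset X} {τ : Finset Y}
    (hτ : ∀ x ∈ σ, f x ∈ τ ∧ g x ∈ τ) {s : Fin (n + 1) → X} (hs : ∀ i, s i ∈ σ)
    (i : Fin (n + 1)) (j : Fin (n + 2)) : prismTuple f g s i j ∈ τ := by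
  unfold prismTuple
  split_ifs
  exacts [(hτ _ (hs _)).2, (hτ _ (hs _)).1]

namespace Contiguous

variable {f g : Hom P Q}

/-- The ordered simplex `(f s₀, …, f sᵢ, g sᵢ, …, g sₙ)`. -/
def prismSimplex (h : Contiguous f g) {n : ℕ} (s : OrdSimplex P.total n) (i : Fin (n + 1)) :
    OrdSimplex Q.total (n + 1) :=
  ⟨prismTuple f.toFun g.toFun s.1 i, by
    obtain ⟨σ, hσ, hs⟩ := s.2
    obtain ⟨τ, hτ, hfg⟩ := h.total σ hσ
    exact ⟨τ, hτ, prismTuple_mem hfg hs i⟩⟩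

/-- The prism operator on ordered chains. -/
def prism (h : Contiguous f g) (G : Type w) [AddCommGroup G] (n : ℕ) :
    SimplicialChain P.total G n →ₗ[ℤ] SimplicialChain Q.total G (n + 1) :=
  Finsupp.lsum ℤ fun s =>
    ∑ i : Fin (n + 1), ((-1 : ℤ) ^ (i : ℕ)) • Finsupp.lsingle (h.prismSimplex s i)

lemma prism_single (h : Contiguous f g) (G : Type w) [AddCommGroup G] (n : ℕ)
    (s : OrdSimplex P.total n) (a : G) :
    h.prism G n (Finsupp.single s a) =
      ∑ i : Fin (n + 1), ((-1 : ℤ) ^ (i : ℕ)) • Finsupp.single (h.prismSimplex s i) a := by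
  simp only [prism, Finsupp.lsum_single, LinearMap.sum_apply, LinearMap.smul_apply,
    Finsupp.lsingle_apply]

lemma toListChain_prism (h : Contiguous f g) (G : Type w) [AddCommGroup G] (n : ℕ)
    (c : SimplicialChain P.total G n) :
    toListChain G Q.total (n + 1) (h.prism G n c) =
      ListChain.prism G f.toFun g.toFun (toListChain G P.total n c) := by
  induction c using Finsupp.induction_linear with
  | zero => simp
  | add c d hc hd => simp only [map_add, hc, hd]
  | single s a =>
    rw [prism_single, toListChain_single, ListChain.prism_single, prismList_ofFn]
    simp only [map_sum, map_smul, toListChain_single]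
    rfl

lemma boundary_prism_succ (h : Contiguous f g) (G : Type w) [AddCommGroup G] (n : ℕ)
    (c : SimplicialChain P.total G (n + 1)) :
    simplicialBoundary Q.total G (n + 1) (h.prism G (n + 1) c) +
        h.prism G n (simplicialBoundary P.total G n c) =
      g.chainMap G (n + 1) c - f.chainMap G (n + 1) c := by
  apply toListChain_injective G (n + 1)
  simp only [map_add, map_sub, toListChain_boundary, toListChain_prism, toListChain_chainMap]
  exact ListChain.boundary_prism G _ _ _

lemma boundary_prism_zero (h : Contiguous f g) (G : Type w) [AddCommGroup G]
    (c : SimplicialChain P.total G 0) :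
    simplicialBoundary Q.total G 0 (h.prism G 0 c) = g.chainMap G 0 c - f.chainMap G 0 c := by
  apply toListChain_injective G 0
  simp only [map_sub, toListChain_boundary, toListChain_prism, toListChain_chainMap]
  rw [← ListChain.boundary_prism, left_eq_add]
  -- The augmentation of a `0`-chain is a multiple of the empty list, whose prism is zero.
  induction c using Finsupp.induction_linear with
  | zero => simp
  | add c d hc hd => simp only [map_add, hc, hd, add_zero]
  | single s a =>
    simp [toListChain_single, ListChain.boundary_single, ListChain.boundaryList,
      ListChain.prism_single, ListChain.prismList]

lemma subChains_le_prism (h : Contiguous f g) (G : Type w) [AddCommGroup G] (n : ℕ) :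
    P.subChains G n ≤ (Q.subChains G (n + 1)).comap (h.prism G n) := by
  rw [subChains_le_iff]
  rintro s ⟨σ, hσ, hs⟩ a
  obtain ⟨τ, hτ, hfg⟩ := h.sub σ hσ
  rw [Submodule.mem_comap, prism_single]
  exact Submodule.sum_mem _ fun i _ => Submodule.smul_mem _ _
    (Finsupp.single_mem_supported ℤ a ⟨τ, hτ, prismTuple_mem hfg hs i⟩)

/-- The prism operator on relative chains. -/
def relPrism (h : Contiguous f g) (G : Type w) [AddCommGroup G] (n : ℕ) :
    P.RelChain G n →ₗ[ℤ] Q.RelChain G (n + 1) :=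
  Submodule.mapQ _ _ (h.prism G n) (h.subChains_le_prism G n)

lemma relBoundary_relPrism_succ (h : Contiguous f g) (G : Type w) [AddCommGroup G] (n : ℕ)
    (c : P.RelChain G (n + 1)) :
    Q.relBoundary G (n + 1) (h.relPrism G (n + 1) c) + h.relPrism G n (P.relBoundary G n c) =
      g.relChainMap G (n + 1) c - f.relChainMap G (n + 1) c := by
  obtain ⟨c, rfl⟩ := Submodule.Quotient.mk_surjective _ c
  exact congrArg Submodule.Quotient.mk (h.boundary_prism_succ G n c)

lemma relBoundary_relPrism_zero (h : Contiguous f g) (G : Type w) [AddCommGroup G]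
    (c : P.RelChain G 0) :
    Q.relBoundary G 0 (h.relPrism G 0 c) = g.relChainMap G 0 c - f.relChainMap G 0 c := by
  obtain ⟨c, rfl⟩ := Submodule.Quotient.mk_surjective _ c
  exact congrArg Submodule.Quotient.mk (h.boundary_prism_zero G c)

/-- Contiguous simplicial maps of pairs induce the same map on homology. -/
theorem homologyMap_eq (h : Contiguous f g) (G : Type w) [AddCommGroup G] (n : ℕ) :
    f.homologyMap G n = g.homologyMap G n := by
  refine LinearMap.ext fun a => ?_
  obtain ⟨⟨c, hc⟩, rfl⟩ := Submodule.Quotient.mk_surjective _ a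
  refine Eq.symm ((Submodule.Quotient.eq _).2 ?_)
  change g.relChainMap G n c - f.relChainMap G n c ∈ Q.boundaries G n
  refine ⟨h.relPrism G n c, ?_⟩
  cases n with
  | zero => exact h.relBoundary_relPrism_zero G c
  | succ n =>
    have hc' : P.relBoundary G n c = 0 := hc
    rw [← h.relBoundary_relPrism_succ G n c, hc', map_zero, add_zero]

/-- Contiguous simplicial maps of pairs induce the same map on cohomology. -/
theorem cohomologyMap_eq (h : Contiguous f g) (G : Type w) [AddCommGroup G] (n : ℕ) :
    f.cohomologyMap G n = g.cohomologyMap G n := by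
  refine LinearMap.ext fun a => ?_
  obtain ⟨⟨φ, hφ⟩, rfl⟩ := Submodule.Quotient.mk_surjective _ a
  refine Eq.symm ((Submodule.Quotient.eq _).2 ?_)
  change g.relCochainMap G n φ - f.relCochainMap G n φ ∈ P.coboundaries G n
  have hφ' (c : Q.RelChain ℤ (n + 1)) : φ (Q.relBoundary ℤ n c) = 0 := LinearMap.congr_fun hφ c
  cases n with
  | zero =>
    refine (Submodule.mem_bot ℤ).2 (LinearMap.ext fun c => ?_)
    change φ (g.relChainMap ℤ 0 c) - φ (f.relChainMap ℤ 0 c) = 0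
    rw [← map_sub, ← h.relBoundary_relPrism_zero ℤ c, hφ']
  | succ n =>
    refine ⟨φ ∘ₗ h.relPrism ℤ n, LinearMap.ext fun c => ?_⟩
    change φ (h.relPrism ℤ n (P.relBoundary ℤ n c)) =
      φ (g.relChainMap ℤ (n + 1) c) - φ (f.relChainMap ℤ (n + 1) c)
    rw [← map_sub, ← h.relBoundary_relPrism_succ ℤ n c, map_add, hφ', zero_add]

end Contiguous

end SimplicialPair

/-! ### Contiguous maps of Vietoris-Rips complexes -/

/-- The two images of a simplex `x₀, …, xₙ` lie in the simplex listed by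
`f x₀, g x₀, f x₁, g x₁, …`. As `f xᵢ` precedes `g xᵢ` in this list, the relation `V` is needed
between them in this direction only. -/
lemma exists_mem_vietorisRips_contiguous {X : Type u} {Y : Type v} {A : Set X} {U : Set (X × X)}
    {B : Set Y} {V : Set (Y × Y)} {f g : X → Y} (hfA : ∀ a ∈ A, f a ∈ B) (hgA : ∀ a ∈ A, g a ∈ B)
    (hself : ∀ x ∈ A, (f x, g x) ∈ V)
    (hU : ∀ x x', (x, x') ∈ U →
      ((f x, f x') ∈ V ∧ (g x, f x') ∈ V) ∧ (f x, g x') ∈ V ∧ (g x, g x') ∈ V)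
    (σ : Finset X) (hσ : σ ∈ vietorisRips A U) :
    ∃ τ ∈ vietorisRips B V, ∀ x ∈ σ, f x ∈ τ ∧ g x ∈ τ := by
  classical
  obtain ⟨hne, hA, l, -, hmem, hl⟩ := hσ
  refine ⟨σ.image f ∪ σ.image g, ⟨(hne.image f).inl, ?_, (l.flatMap fun x => [f x, g x]).dedup,
    List.nodup_dedup _, fun y => ?_, ?_⟩, fun x hx => ?_⟩
  · rw [Finset.coe_union, Finset.coe_image, Finset.coe_image, Set.union_subset_iff]
    exact ⟨Set.image_subset_iff.2 fun x hx => hfA x (hA hx),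
      Set.image_subset_iff.2 fun x hx => hgA x (hA hx)⟩
  · simp only [List.mem_dedup, List.mem_flatMap, List.mem_cons, List.not_mem_nil, or_false,
      Finset.mem_union, Finset.mem_image, hmem]
    grind
  · refine List.Pairwise.sublist (List.dedup_sublist _) (List.pairwise_flatMap.2 ⟨?_, ?_⟩)
    · intro x hx
      simpa using hself x (hA ((hmem x).1 hx))
    · refine hl.imp fun {x x'} h => ?_
      simpa [or_imp, forall_and] using hU x x' h
  · exact ⟨Finset.mem_union_left _ (Finset.mem_image_of_mem f hx),
      Finset.mem_union_right _ (Finset.mem_image_of_mem g hx)⟩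

lemma SimplicialPair.Contiguous.vietorisRips {X : Type u} {Y : Type v} {A : Set X}
    {U : Set (X × X)} {B : Set Y} {V : Set (Y × Y)} {f g : X → Y} (hfA : ∀ a ∈ A, f a ∈ B)
    (hgA : ∀ a ∈ A, g a ∈ B) (hf : ∀ x x', (x, x') ∈ U → (f x, f x') ∈ V)
    (hg : ∀ x x', (x, x') ∈ U → (g x, g x') ∈ V) (hself : ∀ x, (f x, g x) ∈ V)
    (hfg : ∀ x x', (x, x') ∈ U → (f x, g x') ∈ V) (hgf : ∀ x x', (x, x') ∈ U → (g x, f x') ∈ V) :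
    SimplicialPair.Contiguous (vietorisRipsMap f hfA hf) (vietorisRipsMap g hgA hg) where
  total := exists_mem_vietorisRips_contiguous (fun _ _ => Set.mem_univ _)
    (fun _ _ => Set.mem_univ _) (fun x _ => hself x)
    fun x x' h => ⟨⟨hf x x' h, hgf x x' h⟩, hfg x x' h, hg x x' h⟩
  sub := exists_mem_vietorisRips_contiguous hfA hgA
    (fun x hx => ⟨hself x, hfA x hx, hgA x hx⟩)
    fun x x' ⟨h, hx, hx'⟩ => ⟨⟨⟨hf x x' h, hfA x hx, hfA x' hx'⟩, hgf x x' h, hgA x hx, hfA x' hx'⟩,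
      ⟨hfg x x' h, hfA x hx, hgA x' hx'⟩, hg x x' h, hgA x hx, hgA x' hx'⟩

/-! ### Subdivision of a homotopy -/

namespace SemiUniformity

/-- A member of the topological semi-uniform structure contains the square of a neighbourhood of
each point. -/
lemma exists_isOpen_of_mem_topological {Z : Type u} [TopologicalSpace Z] {W : Set (Z × Z)}
    (hW : W ∈ (topological Z).entourages) (z : Z) :
    ∃ O : Set Z, IsOpen O ∧ z ∈ O ∧ ∀ s ∈ O, ∀ t ∈ O, (s, t) ∈ W := by
  induction hW with
  | basic h =>
    obtain ⟨𝒰, h𝒰, rfl⟩ := h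
    obtain ⟨U, hU, hz⟩ := h𝒰 z
    exact ⟨interior U, isOpen_interior, hz, fun s hs t ht =>
      ⟨U, hU, interior_subset hs, interior_subset ht⟩⟩
  | univ => exact ⟨Set.univ, isOpen_univ, trivial, fun _ _ _ _ => trivial⟩
  | superset _ hst ih =>
    obtain ⟨O, hO, hz, h⟩ := ih
    exact ⟨O, hO, hz, fun s hs t ht => hst (h s hs t ht)⟩
  | inter _ _ ih₁ ih₂ =>
    obtain ⟨O₁, hO₁, hz₁, h₁⟩ := ih₁
    obtain ⟨O₂, hO₂, hz₂, h₂⟩ := ih₂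
    exact ⟨O₁ ∩ O₂, hO₁.inter hO₂, ⟨hz₁, hz₂⟩, fun s hs t ht =>
      ⟨h₁ s hs.1 t ht.1, h₂ s hs.2 t ht.2⟩⟩

/-- By compactness, `[0, 1]` is subdivided so finely that the endpoints of each part are related,
in both directions, by a given member of the topological semi-uniform structure. -/
lemma exists_subdivision {W : Set (unitInterval × unitInterval)}
    (hW : W ∈ (topological unitInterval).entourages) :
    ∃ (t : ℕ → unitInterval) (N : ℕ), t 0 = 0 ∧ t N = 1 ∧
      ∀ k, ((t k, t k) ∈ W ∧ (t k, t (k + 1)) ∈ W) ∧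
        (t (k + 1), t k) ∈ W ∧ (t (k + 1), t (k + 1)) ∈ W := by
  choose O hO hzO hOW using exists_isOpen_of_mem_topological hW
  obtain ⟨t, ht0, hmono, ⟨N, hN⟩, ht⟩ := exists_monotone_Icc_subset_open_cover_unitInterval hO
    fun z _ => Set.mem_iUnion.2 ⟨z, hzO z⟩
  refine ⟨t, N, ht0, hN N le_rfl, fun k => ?_⟩
  obtain ⟨z, hz⟩ := ht k
  have h₀ : t k ∈ O z := hz (Set.left_mem_Icc.2 (hmono k.le_succ))
  have h₁ : t (k + 1) ∈ O z := hz (Set.right_mem_Icc.2 (hmono k.le_succ))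
  exact ⟨⟨hOW z _ h₀ _ h₀, hOW z _ h₀ _ h₁⟩, hOW z _ h₁ _ h₀, hOW z _ h₁ _ h₁⟩

variable {X : Type u} {Y : Type v} {FX : SemiUniformity X} {FY : SemiUniformity Y}

lemma UniformlyContinuous.exists_of_prod {Z : Type*} {FZ : SemiUniformity Z} {H : X × Z → Y}
    (hH : UniformlyContinuous (FX.prod FZ) FY H) {V : Set (Y × Y)} (hV : V ∈ FY.entourages) :
    ∃ U ∈ FX.entourages, ∃ W ∈ FZ.entourages, ∀ x x' z z', (x, x') ∈ U → (z, z') ∈ W →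
      (H (x, z), H (x', z')) ∈ V := by
  obtain ⟨_, ⟨_, ⟨U, hU, hUT⟩, _, ⟨W, hW, hWT⟩, rfl⟩, h⟩ := hH V hV
  exact ⟨U, hU, W, hW, fun x x' z z' hx hz => h (x, z) (x', z') ⟨hUT hx, hWT hz⟩⟩

variable {A : Set X} {B : Set Y} {f₀ f₁ : PairMap FX A FY B}

/-- Homotopic maps agree on the homology and cohomology of sufficiently fine Vietoris-Rips
pairs. -/
theorem Homotopic.exists_simplicialMap_eq (h : Homotopic f₀ f₁) (V : FY.Entourage) :
    ∃ (U : FX.Entourage) (h₀ : U ≤ f₀.pullback V) (h₁ : U ≤ f₁.pullback V),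
      ∀ (G : Type w) [AddCommGroup G] (n : ℕ),
        (f₀.simplicialMap h₀).homologyMap G n = (f₁.simplicialMap h₁).homologyMap G n ∧
        (f₀.simplicialMap h₀).cohomologyMap G n = (f₁.simplicialMap h₁).cohomologyMap G n := by
  obtain ⟨H, hH, hH₀, hH₁, hHA⟩ := h
  obtain ⟨U, hU, W, hW, hUW⟩ := hH.exists_of_prod V.2
  obtain ⟨t, N, ht₀, htN, ht⟩ := exists_subdivision hW
  have hdiag (x : X) : (x, x) ∈ U := FX.diag_mem U hU x
  let stage (k : ℕ) : (vietorisRipsPair A U).Hom (vietorisRipsPair B V.1) :=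
    vietorisRipsMap (fun x => H (x, t k)) (fun a ha => hHA a ha (t k))
      fun x x' hx => hUW x x' _ _ hx (ht k).1.1
  have hstage (k : ℕ) : SimplicialPair.Contiguous (stage k) (stage (k + 1)) :=
    .vietorisRips _ _ _ _ (fun x => hUW x x _ _ (hdiag x) (ht k).1.2)
      (fun x x' hx => hUW x x' _ _ hx (ht k).1.2) fun x x' hx => hUW x x' _ _ hx (ht k).2.1
  have e₀ : (fun x => H (x, t 0)) = f₀.toFun := funext fun x => by rw [ht₀, hH₀]
  have e₁ : (fun x => H (x, t N)) = f₁.toFun := funext fun x => by rw [htN, hH₁]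
  have h₀ : (⟨U, hU⟩ : FX.Entourage) ≤ f₀.pullback V := fun p hp => by
    change (f₀.toFun p.1, f₀.toFun p.2) ∈ V.1
    rw [← e₀]
    exact hUW p.1 p.2 _ _ hp (ht 0).1.1
  have h₁ : (⟨U, hU⟩ : FX.Entourage) ≤ f₁.pullback V := fun p hp => by
    change (f₁.toFun p.1, f₁.toFun p.2) ∈ V.1
    rw [← e₁]
    exact hUW p.1 p.2 _ _ hp (ht N).1.1
  have s₀ : stage 0 = f₀.simplicialMap h₀ := by
    simp only [stage, PairMap.simplicialMap, e₀]
  have s₁ : stage N = f₁.simplicialMap h₁ := by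
    simp only [stage, PairMap.simplicialMap, e₁]
  refine ⟨⟨U, hU⟩, h₀, h₁, fun G _ n => ?_⟩
  rw [← s₀, ← s₁]
  clear s₁ h₁ e₁ htN
  induction N with
  | zero => exact ⟨rfl, rfl⟩
  | succ N ih =>
    exact ⟨ih.1.trans ((hstage N).homologyMap_eq G n), ih.2.trans ((hstage N).cohomologyMap_eq G n)⟩

end SemiUniformity

end

theorem mainTheorem1 {X : Type u} {Y : Type v} (FX : SemiUniformity X) (FY : SemiUniformity Y)
    (A : Set X) (B : Set Y) (f₀ f₁ : SemiUniformity.PairMap FX A FY B)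
    (h : SemiUniformity.Homotopic f₀ f₁) (G : Type w) [AddCommGroup G] (n : ℕ) :
    f₀.homologyMap G n = f₁.homologyMap G n ∧ f₀.cohomologyMap G n = f₁.cohomologyMap G n := by
  classical
  constructor
  · refine LinearMap.ext fun a => Subtype.ext (funext fun V => ?_)
    obtain ⟨U, h₀, h₁, hUV⟩ := h.exists_simplicialMap_eq V
    rw [f₀.homologyMap_apply G n a h₀, f₁.homologyMap_apply G n a h₁, (hUV G n).1]
  · refine Module.DirectLimit.hom_ext fun V => LinearMap.ext fun b => ?_
    obtain ⟨U, h₀, h₁, hUV⟩ := h.exists_simplicialMap_eq (OrderDual.ofDual V)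
    exact (f₀.cohomologyMap_of G n h₀ b).trans
      ((congrArg (fun m => FX.vrCohomologyOf A G n U (m b)) (hUV G n).2).trans
        (f₁.cohomologyMap_of G n h₁ b).symm)
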